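/- Let $SE(2)=\mathbb{R}^2\rtimes SO(2)$, with elements $g=(\mathbf t,R)$, group law $(\mathbf t,R)(\mathbf t',R')=(\mathbf t+R\mathbf t',RR')$ and Haar measure $dg=\frac1{4\pi^2}\,dx_1\,dx_2\,d\theta$ for $g=g(x_1,x_2,\theta)=((x_1,x_2),R_\theta)$, where $R_\theta$ is the rotation by $\theta\in(0,2\pi]$. Let $\Gamma=\mathbb{Z}^2$ be the subgroup of translations by integral vectors and, for $\mathbf k=(k_1,k_2,k_3)\in\mathbb{Z}^3$, let $\psi_{\mathbf k}:\Gamma\backslash SE(2)\to\mathbb{C}$ be the canonical basis function $$\psi_{\mathbf k}(\Gamma g(x_1,x_2,\theta))=e^{2\pi i(k_1x_1+k_2x_2)}e^{ik_3\theta}.$$ For $\varepsilon\in\{1,-1\}$ and $p>0$ let $$[U^{\varepsilon}_p(\mathbf t,R)\varphi](\mathbf u)=e^{\varepsilon i p\langle\mathbf u,\mathbf t\rangle}\varphi(R^{T}\mathbf u)\qquad(\mathbf u\in\mathbb{S}^1)$$ be the irreducible unitary representation of $SE(2)$ on $L^2(\mathbb{S}^1)$ (the two signs are the two usual conventions), and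 put $\mathrm u^{\varepsilon}_{mn}(g,p)=\langle U^{\varepsilon}_p(g)\mathbf e_m,\mathbf e_n\rangle$ for $m,n\in\mathbb{Z}$, where $\mathbf e_k(\cos\alpha,\sin\alpha)=e^{ik\alpha}$ and $\langle\varphi,\psi\rangle=\frac1{2\pi}\int_0^{2\pi}\varphi\overline{\psi}\,d\alpha$. Let $$Q^{\mathbf k,\varepsilon}(p)_{mn}=\int_{SE(2)}\mathrm u^{\varepsilon}_{mn}(g,p)\,\overline{\psi_{\mathbf k}(\Gamma g)}\,dg,$$ an integral of distributions in the variable $p\in(0,\infty)$: its value on a test function $\chi\in C_c^\infty((0,\infty))$ is $\int_{SE(2)}\big(\int_0^\infty\chi(p)\,\mathrm u^{\varepsilon}_{mn}(g,p)\,dp\big)\overline{\psi_{\mathbf k}(\Gamma g)}\,dg$. Theorem. Let $m,n\in\mathbb{Z}$ and $\mathbf k\in\mathbb{Z}^3$ with $(k_1,k_2)\neq(0,0)$, and let $\Phi(k_1,k_2)\in[0,2\pi)$ be the angle with $(k_1,k_2)=\sqrt{k_1^2+k_2^2}\,(\cos\Phi(k_1,k_2),\sin\Phi(k_1,k_2))$.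 Then, for every $\chi$, the outer integral over $SE(2)$ above converges absolutely, and as distributions in $p\in(0,\infty)$ $$Q^{\mathbf k,+1}(p)_{mn}=\frac{\delta_{k_3,-m}\,e^{i(m-n)\Phi(k_1,k_2)}}{2\pi\sqrt{k_1^2+k_2^2}}\;\delta\!\left(p-2\pi\sqrt{k_1^2+k_2^2}\right),$$ $$Q^{\mathbf k,-1}(p)_{mn}=(-1)^{m-n}\,\frac{\delta_{k_3,-m}\,e^{i(m-n)\Phi(k_1,k_2)}}{2\pi\sqrt{k_1^2+k_2^2}}\;\delta\!\left(p-2\pi\sqrt{k_1^2+k_2^2}\right).$$ -/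

import Mathlib

open MeasureTheory
open scoped Distributions ComplexConjugate

noncomputable section

/-- The Euclidean plane `ℝ²`. -/
abbrev Plane : Type := EuclideanSpace ℝ (Fin 2)

/-- The special orthogonal group `SO(2)`. -/
abbrev SO2 : Type := Matrix.specialOrthogonalGroup (Fin 2) ℝ

/-- The product `R x` of `R ∈ SO(2)` with a column vector `x ∈ ℝ²`. -/
def SO2.act (R : SO2) (x : Plane) : Plane := WithLp.toLp 2 (R.1.mulVec x.ofLp)

theorem SO2.act_mul (R S : SO2) (x : Plane) : (R * S).act x = R.act (S.act x) := by
  simp only [SO2.act, Submonoid.coe_mul, Matrix.mulVec_mulVec]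

theorem SO2.act_one (x : Plane) : SO2.act 1 x = x := by
  simp [SO2.act]

theorem SO2.act_add (R : SO2) (x y : Plane) : R.act (x + y) = R.act x + R.act y := by
  simp only [SO2.act, WithLp.ofLp_add, Matrix.mulVec_add, WithLp.toLp_add]

theorem SO2.act_neg (R : SO2) (x : Plane) : R.act (-x) = -R.act x := by
  simp only [SO2.act, WithLp.ofLp_neg, Matrix.mulVec_neg, WithLp.toLp_neg]

theorem SO2.coe_inv (R : SO2) : (R⁻¹ : SO2).1 = R.1.transpose := by
  ext i j
  change (star R.1) i j = _
  simp [Matrix.star_apply]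

theorem SO2.inner_act (R : SO2) (x y : Plane) :
    inner ℝ (R⁻¹.act x) y = inner ℝ x (R.act y) := by
  simp [SO2.act, SO2.coe_inv, PiLp.inner_apply, Fin.sum_univ_two]
  ring

theorem SO2.norm_act (R : SO2) (x : Plane) : ‖R.act x‖ = ‖x‖ := by
  have h := SO2.inner_act R⁻¹ x (R.act x)
  rw [inv_inv, ← SO2.act_mul, inv_mul_cancel, SO2.act_one] at h
  have h2 : ‖R.act x‖ ^ 2 = ‖x‖ ^ 2 := by
    rw [← real_inner_self_eq_norm_sq, ← real_inner_self_eq_norm_sq, h]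
  exact (sq_eq_sq₀ (norm_nonneg _) (norm_nonneg _)).1 h2

/-- The rotation matrix `R_θ`. -/
def SO2.rot (θ : ℝ) : SO2 :=
  ⟨!![Real.cos θ, -Real.sin θ; Real.sin θ, Real.cos θ], by
    rw [Matrix.of_mem_specialOrthogonalGroup_fin_two_iff]
    exact ⟨rfl, rfl, by nlinarith [Real.sin_sq_add_cos_sq θ]⟩⟩

/-- The special Euclidean group `SE(2) = ℝ² ⋊ SO(2)`, with elements `(t, R)`. -/
@[ext]
structure SE2 where
  t : Plane
  R : SO2

namespace SE2

instance : Mul SE2 := ⟨fun g h => ⟨g.t + g.R.act h.t, g.R * h.R⟩⟩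
instance : One SE2 := ⟨⟨0, 1⟩⟩
instance : Inv SE2 := ⟨fun g => ⟨-(g.R⁻¹.act g.t), g.R⁻¹⟩⟩

theorem mul_def (g h : SE2) : g * h = ⟨g.t + g.R.act h.t, g.R * h.R⟩ := rfl
theorem one_def : (1 : SE2) = ⟨0, 1⟩ := rfl
theorem inv_def (g : SE2) : g⁻¹ = ⟨-(g.R⁻¹.act g.t), g.R⁻¹⟩ := rfl

instance : Group SE2 :=
  Group.ofLeftAxioms
    (fun a b c => by
      simp only [mul_def, SO2.act_mul, SO2.act_add, mul_assoc, add_assoc])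
    (fun a => by simp [mul_def, one_def, SO2.act_one])
    (fun a => by simp [mul_def, one_def, inv_def])

instance : TopologicalSpace SE2 :=
  TopologicalSpace.induced (fun g : SE2 => (g.t, g.R)) inferInstance

instance : MeasurableSpace SE2 := borel SE2

instance : BorelSpace SE2 := ⟨rfl⟩

/-- The element `g(x₁, x₂, θ) = ((x₁, x₂), R_θ)` of `SE(2)`, for `q = (x₁, x₂, θ)`. -/
def ofCoord (q : ℝ × ℝ × ℝ) : SE2 := ⟨!₂[q.1, q.2.1], SO2.rot q.2.2⟩

theorem continuous_ofCoord : Continuous ofCoord := by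
  rw [continuous_induced_rng]
  refine Continuous.prodMk ?_ ?_
  · refine (PiLp.continuous_toLp 2 _).comp (continuous_pi fun i => ?_)
    fin_cases i <;> simp <;> fun_prop
  · refine Continuous.subtype_mk (continuous_matrix fun i j => ?_) _
    fin_cases i <;> fin_cases j <;> simp <;> fun_prop

/-- The normalized Haar measure `dg = (4π²)⁻¹ dx₁ dx₂ dθ` on `SE(2)`, `θ ∈ (0, 2π]`. -/
def haar : Measure SE2 :=
  ENNReal.ofReal (1 / (4 * Real.pi ^ 2)) •
    (volume.restrict {q : ℝ × ℝ × ℝ | q.2.2 ∈ Set.Ioc 0 (2 * Real.pi)}).map ofCoord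

/-- The lattice `ℤ²`, as the subgroup of translations of `SE(2)` by integral vectors. -/
def lattice : Subgroup SE2 where
  carrier := {g | g.R = 1 ∧ ∃ a b : ℤ, g.t = !₂[(a : ℝ), (b : ℝ)]}
  one_mem' := ⟨rfl, 0, 0, by ext i; fin_cases i <;> simp [one_def]⟩
  mul_mem' := by
    rintro g h ⟨hg, a, b, hab⟩ ⟨hh, c, d, hcd⟩
    refine ⟨by simp [mul_def, hg, hh], a + c, b + d, ?_⟩
    simp only [mul_def, hg, SO2.act_one, hab, hcd]
    ext i; fin_cases i <;> simp
  inv_mem' := by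
    rintro g ⟨hg, a, b, hab⟩
    refine ⟨by simp [inv_def, hg], -a, -b, ?_⟩
    simp only [inv_def, hg, inv_one, SO2.act_one, hab]
    ext i; fin_cases i <;> simp

/-- The right coset space `ℤ² \ SE(2) = {ℤ² g : g ∈ SE(2)}`. -/
abbrev CosetSpace : Type := Quotient (QuotientGroup.rightRel lattice)

/-- The coset `ℤ² g`. -/
def coset (g : SE2) : CosetSpace := Quotient.mk _ g

/-- The canonical basis function `ψ_k` on `ℤ² \ SE(2)`: the class of `(x, R_θ)` is sent to
`exp(2πi(k₁x₁ + k₂x₂)) exp(i k₃ θ)`, where `exp(iθ) = cos θ + i sin θ` is read off the first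
column of `R_θ`. -/
def psi (k₁ k₂ k₃ : ℤ) : CosetSpace → ℂ :=
  Quotient.lift
    (fun g : SE2 =>
      Complex.exp (2 * Real.pi * Complex.I * (k₁ * (g.t 0 : ℂ) + k₂ * (g.t 1 : ℂ))) *
        ((g.R.1 0 0 : ℂ) + (g.R.1 1 0 : ℂ) * Complex.I) ^ k₃)
    (by
      intro g h hgh
      obtain ⟨hR, a, b, hab⟩ := (QuotientGroup.rightRel_apply.1 hgh : h * g⁻¹ ∈ lattice)
      have hh : h = (h * g⁻¹) * g := by group
      generalize h * g⁻¹ = l at hR hab hh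
      subst hh
      have e : Complex.exp (2 * Real.pi * Complex.I * (k₁ * (a : ℂ) + k₂ * (b : ℂ))) = 1 := by
        rw [Complex.exp_eq_one_iff]
        exact ⟨k₁ * a + k₂ * b, by push_cast; ring⟩
      simp only [mul_def, hR, SO2.act_one, hab, one_mul, PiLp.add_apply]
      congr 1
      rw [← one_mul (Complex.exp _), ← e, ← Complex.exp_add]
      congr 1
      simp
      ring)

theorem psi_coset_ofCoord (k₁ k₂ k₃ : ℤ) (x y θ : ℝ) :
    psi k₁ k₂ k₃ (coset (ofCoord (x, y, θ))) =
      Complex.exp (2 * Real.pi * Complex.I * (k₁ * x + k₂ * y)) *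
        Complex.exp (Complex.I * k₃ * θ) := by
  have h : Complex.exp (Complex.I * k₃ * θ) = Complex.exp (θ * Complex.I) ^ k₃ := by
    rw [← Complex.exp_int_mul]; congr 1; ring
  rw [h, Complex.exp_mul_I]
  simp [psi, coset, ofCoord, SO2.rot]

end SE2

/-- The unit circle `𝕊¹ ⊆ ℝ²`. -/
abbrev S1 : Type := Metric.sphere (0 : Plane) 1

namespace S1

/-- The point `u_α = (cos α, sin α)` of the unit circle. -/
def pt (α : ℝ) : S1 :=
  ⟨!₂[Real.cos α, Real.sin α], by simp [EuclideanSpace.norm_eq, Fin.sum_univ_two]⟩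

/-- Rotation of a point of the unit circle by an element of `SO(2)`. -/
def rotate (R : SO2) (u : S1) : S1 :=
  ⟨R.act u.1, by simp [SO2.norm_act]⟩

/-- The basis function `e_k` of `L²(𝕊¹)`, `e_k(cos α, sin α) = exp(i k α)`. -/
def e (k : ℤ) (u : S1) : ℂ := ((u.1 0 : ℂ) + (u.1 1 : ℂ) * Complex.I) ^ k

theorem e_pt (k : ℤ) (α : ℝ) : e k (pt α) = Complex.exp (Complex.I * k * α) := by
  have h : Complex.exp (Complex.I * k * α) = Complex.exp (α * Complex.I) ^ k := by
    rw [← Complex.exp_int_mul]; congr 1; ring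
  rw [h, Complex.exp_mul_I]
  simp [e, pt]

/-- The inner product `⟨φ, ψ⟩ = (2π)⁻¹ ∫₀^{2π} φ(u_α) conj(ψ(u_α)) dα` of `L²(𝕊¹)`. -/
def innerL2 (φ ψ : S1 → ℂ) : ℂ :=
  1 / (2 * Real.pi) * ∫ α in (0 : ℝ)..(2 * Real.pi), φ (pt α) * conj (ψ (pt α))

end S1

namespace SE2

/-- The representation `U_p` of `SE(2)` on functions on the circle,
`[U_p(t, R) φ](u) = exp(-i p ⟨u, t⟩) φ(Rᵀ u)`. It is written down for every real `p`;
`U_{-p}` is the same formula with `exp(+i p ⟨u, t⟩)`. -/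
def U (p : ℝ) : Representation ℂ SE2 (S1 → ℂ) where
  toFun g :=
    { toFun := fun φ u =>
        Complex.exp (-(Complex.I * p * (inner ℝ u.1 g.t : ℝ))) * φ (S1.rotate g.R⁻¹ u)
      map_add' := fun φ ψ => by ext u; simp [mul_add]
      map_smul' := fun c φ => by ext u; simp [mul_left_comm] }
  map_one' := by
    ext φ u
    simp [one_def, S1.rotate, SO2.act_one]
  map_mul' g h := by
    ext φ u
    simp only [mul_def, LinearMap.coe_mk, AddHom.coe_mk, Module.End.mul_apply, S1.rotate,
      mul_inv_rev, SO2.act_mul, SO2.inner_act, inner_add_right, ← mul_assoc,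
      ← Complex.exp_add]
    congr 2
    push_cast
    ring

/-- The matrix elements `u_{mn}(g, p) = ⟨U_p(g) e_m, e_n⟩`. -/
def u (m n : ℤ) (g : SE2) (p : ℝ) : ℂ := S1.innerL2 (U p g (S1.e m)) (S1.e n)

end SE2

/-- The open half line `(0, ∞)`, over which the parameter `p` ranges. -/
def PosLine : TopologicalSpace.Opens ℝ := ⟨Set.Ioi 0, isOpen_Ioi⟩

/-- The regular distribution `χ ↦ ∫₀^∞ χ(p) f(p) dp` on `(0, ∞)` of a locally integrable
function `f`. -/
def regularDistribution (f : ℝ → ℂ) : 𝓓'(PosLine, ℂ) :=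
  (TestFunction.integralAgainstBilinCLM (ContinuousLinearMap.lsmul ℝ ℝ)
    (volume.restrict (Set.Ioi 0)) f : 𝓓(PosLine, ℝ) →L[ℝ] ℂ)

/-- The Dirac distribution `δ(p - a)` on `(0, ∞)`, with complex values. -/
def dirac (a : ℝ) : 𝓓'(PosLine, ℂ) :=
  Distribution.mapCLM Complex.ofRealCLM (Distribution.delta a)

/-- The distribution `T` on `(0, ∞)` is the integral `∫ G(x) dμ(x)` of the family `G` of
distributions: for every test function `χ` the function `x ↦ ⟨G(x), χ⟩` is absolutely
integrable and `⟨T, χ⟩` is its integral. -/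
def IsDistributionIntegral {X : Type*} [MeasurableSpace X] (μ : Measure X)
    (G : X → 𝓓'(PosLine, ℂ)) (T : 𝓓'(PosLine, ℂ)) : Prop :=
  ∀ χ : 𝓓(PosLine, ℝ), Integrable (fun x => G x χ) μ ∧ T χ = ∫ x, G x χ ∂μ

namespace SE2

/-- For a kernel `w(g, p)` in the role of the matrix element `u_{mn}(g, p)`, the distribution `Q`
in the variable `p > 0` is `∫_{SE(2)} w(g, p) conj(ψ_k(ℤ² g)) dg`. -/
def IsQ (k₁ k₂ k₃ : ℤ) (w : SE2 → ℝ → ℂ) (Q : 𝓓'(PosLine, ℂ)) : Prop :=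
  IsDistributionIntegral haar
    (fun g => regularDistribution fun p => w g p * conj (psi k₁ k₂ k₃ (coset g))) Q

end SE2

/-- The polar angle `Φ(x, y) ∈ [0, 2π)`. -/
def polarAngle (x y : ℝ) : ℝ :=
  toIcoMod Real.two_pi_pos 0 (Complex.arg ⟨x, y⟩)

theorem polarAngle_mem (x y : ℝ) : polarAngle x y ∈ Set.Ico 0 (2 * Real.pi) := by
  simpa [polarAngle] using toIcoMod_mem_Ico Real.two_pi_pos 0 (Complex.arg ⟨x, y⟩)

theorem polarAngle_spec (x y : ℝ) :
    x = Real.sqrt (x ^ 2 + y ^ 2) * Real.cos (polarAngle x y) ∧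
      y = Real.sqrt (x ^ 2 + y ^ 2) * Real.sin (polarAngle x y) := by
  have hn : ‖(⟨x, y⟩ : ℂ)‖ = Real.sqrt (x ^ 2 + y ^ 2) := by
    rw [Complex.norm_def, Complex.normSq_mk]; congr 1; ring
  have hp : polarAngle x y = Complex.arg ⟨x, y⟩ -
      (toIcoDiv Real.two_pi_pos 0 (Complex.arg ⟨x, y⟩) : ℤ) * (2 * Real.pi) := by
    rw [polarAngle, toIcoMod, zsmul_eq_mul]
  rw [hp, Real.cos_sub_int_mul_two_pi, Real.sin_sub_int_mul_two_pi, ← hn,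
    Complex.norm_mul_cos_arg, Complex.norm_mul_sin_arg]
  exact ⟨rfl, rfl⟩

end

/-! Tested against `χ`, the matrix element becomes a Fourier transform on the plane. With the plane
read as ℂ, `u_{mn}(g, σp)` is `conj R ^ m` times the circle average of `exp(-iσp⟨u, t⟩)
e^{i(m-n)α}`. Integrating this against `χ(p) dp` is integration in polar coordinates of `f(z) =
χ(|z|) |z|⁻¹ (z/|z|)^(m-n)`, where `|z|⁻¹` absorbs the Jacobian. The outcome is `𝓕 f` at `σt/(2π)`
(`SE2.regularDistribution_u_apply`).

Since `χ` vanishes near 0, `f` is smooth with compact support, so `𝓕 f` is Schwartz and the outer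
integral converges absolutely. The integrand splits into a function of `t` times a function of `θ`.
The `θ`-integral is the Kronecker delta; the `t`-integral against the character of `k` is Fourier
inversion (`integral_exp_mul_fourier_smul`) and returns `f(-2πσ(k₁, k₂))`. The modulus of that point
gives the Dirac mass and its weight, and its direction gives the phase.

The sign `σ = ±1` treats both conventions at once: `σ = -1` is `ε = +1`. For `σ = 1` the inversion
point is opposite to `(k₁, k₂)`, whence `(-1)^(m-n)`. -/

open scoped FourierTransform

/-! ### The angular test function is Schwartz -/

/-- The function `z ↦ χ(|z|) |z|⁻¹ (z/|z|)^j` on the plane. -/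
noncomputable def angularFunction (χ : 𝓓(PosLine, ℝ)) (j : ℤ) (z : ℂ) : ℂ :=
  (χ ‖z‖ : ℂ) * (‖z‖ : ℂ)⁻¹ * (z * (‖z‖ : ℂ)⁻¹) ^ j

theorem contDiffAt_zpow_of_ne_zero {f : ℂ → ℂ} {z : ℂ} (hf : ContDiffAt ℝ (⊤ : ℕ∞) f z)
    (hz : f z ≠ 0) (j : ℤ) : ContDiffAt ℝ (⊤ : ℕ∞) (fun z => f z ^ j) z := by
  cases j with
  | ofNat k => simpa using hf.pow k
  | negSucc k =>
    simp only [zpow_negSucc]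
    exact (hf.pow (k + 1)).inv (pow_ne_zero _ hz)

theorem TestFunction.eq_zero_of_nonpos (χ : 𝓓(PosLine, ℝ)) {r : ℝ} (hr : r ≤ 0) : χ r = 0 := by
  refine image_eq_zero_of_notMem_tsupport fun h => ?_
  exact absurd (χ.tsupport_subset h) (not_lt.2 hr)

/-- The only possible singularity is the origin, and the support of `χ` is a closed set inside `(0,
∞)`, so the function vanishes on a whole neighbourhood of 0. -/
theorem contDiff_angularFunction (χ : 𝓓(PosLine, ℝ)) (j : ℤ) :
    ContDiff ℝ (⊤ : ℕ∞) (angularFunction χ j) := by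
  rw [contDiff_iff_contDiffAt]
  intro z
  by_cases hz : z = 0
  · subst hz
    have h0 : (0 : ℝ) ∉ tsupport χ := fun h => lt_irrefl (0 : ℝ) (χ.tsupport_subset h)
    have h1 : ∀ᶠ z : ℂ in nhds 0, χ ‖z‖ = 0 := by
      have h2 := notMem_tsupport_iff_eventuallyEq.1 h0
      have h3 : Filter.Tendsto (fun z : ℂ => ‖z‖) (nhds 0) (nhds 0) := by
        simpa using (continuous_norm (E := ℂ)).tendsto 0
      exact h3.eventually h2
    refine (contDiffAt_const (c := (0 : ℂ))).congr_of_eventuallyEq ?_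
    filter_upwards [h1] with z hz
    simp [angularFunction, hz]
  · have hn : ContDiffAt ℝ (⊤ : ℕ∞) (fun z : ℂ => ‖z‖) z := contDiffAt_norm ℝ hz
    have hc : ContDiffAt ℝ (⊤ : ℕ∞) (fun z : ℂ => ((‖z‖ : ℝ) : ℂ)) z :=
      Complex.ofRealCLM.contDiff.contDiffAt.comp z hn
    have hz' : ((‖z‖ : ℝ) : ℂ) ≠ 0 := by simpa using hz
    have hi := hc.inv hz'
    have hχ : ContDiffAt ℝ (⊤ : ℕ∞) (fun z : ℂ => ((χ ‖z‖ : ℝ) : ℂ)) z :=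
      Complex.ofRealCLM.contDiff.contDiffAt.comp z (χ.contDiff.contDiffAt.comp z hn)
    exact (hχ.mul hi).mul
      (contDiffAt_zpow_of_ne_zero (contDiffAt_id.mul hi) (mul_ne_zero hz (inv_ne_zero hz')) j)

theorem hasCompactSupport_angularFunction (χ : 𝓓(PosLine, ℝ)) (j : ℤ) :
    HasCompactSupport (angularFunction χ j) := by
  obtain ⟨R, hR⟩ := χ.hasCompactSupport.isCompact.isBounded.subset_closedBall (0 : ℝ)
  refine HasCompactSupport.intro (isCompact_closedBall (0 : ℂ) R) fun z hz => ?_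
  have : χ ‖z‖ = 0 := image_eq_zero_of_notMem_tsupport fun h => hz (by simpa using hR h)
  simp [angularFunction, this]

/-- `angularFunction` as a Schwartz function. -/
noncomputable def angularSchwartz (χ : 𝓓(PosLine, ℝ)) (j : ℤ) : SchwartzMap ℂ ℂ :=
  (hasCompactSupport_angularFunction χ j).toSchwartzMap (contDiff_angularFunction χ j)

theorem angularSchwartz_apply (χ : 𝓓(PosLine, ℝ)) (j : ℤ) (z : ℂ) :
    angularSchwartz χ j z = angularFunction χ j z := rfl

/-! ### Its Fourier transform in polar coordinates -/

/-- The polar Jacobian `r` cancels `|z|⁻¹`, leaving exactly the measure `χ(r) dr dα` of the pairing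
with `χ`. -/
theorem angularFunction_polar (χ : 𝓓(PosLine, ℝ)) (j : ℤ) {r : ℝ} (hr : 0 < r) (α : ℝ) :
    (r : ℂ) * angularFunction χ j (r * Complex.exp (α * Complex.I)) =
      χ r * Complex.exp (Complex.I * j * α) := by
  have hn : ‖(r : ℂ) * Complex.exp (α * Complex.I)‖ = r := by
    rw [norm_mul, Complex.norm_exp_ofReal_mul_I, mul_one, Complex.norm_real, Real.norm_of_nonneg hr.le]
  have hr' : (r : ℂ) ≠ 0 := by exact_mod_cast hr.ne'
  have h1 : (r : ℂ) * Complex.exp (α * Complex.I) * (r : ℂ)⁻¹ = Complex.exp (α * Complex.I) := by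
    field_simp
  rw [angularFunction, hn, h1, ← Complex.exp_int_mul]
  field_simp

/-- The Fourier transform of `angularFunction` in polar coordinates. -/
theorem fourier_angularSchwartz (χ : 𝓓(PosLine, ℝ)) (j : ℤ) (w : ℂ) :
    𝓕 (angularSchwartz χ j) w = ∫ r in Set.Ioi (0 : ℝ), (χ r : ℂ) *
      ∫ α in (0 : ℝ)..(2 * Real.pi),
        Complex.exp (-(2 * Real.pi * r * (w.re * Real.cos α + w.im * Real.sin α) * Complex.I)) *
          Complex.exp (Complex.I * j * α) := by
  rw [SchwartzMap.fourier_coe, Real.fourier_eq', ← Complex.integral_comp_polarCoord_symm]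
  set F : ℝ → ℝ → ℂ := fun r α =>
    Complex.exp (-(2 * Real.pi * r * (w.re * Real.cos α + w.im * Real.sin α) * Complex.I)) *
          Complex.exp (Complex.I * j * α) with hF
  have h1 : ∀ p ∈ polarCoord.target,
      p.1 • (Complex.exp (((-2 * Real.pi * inner ℝ (Complex.polarCoord.symm p) w : ℝ) : ℂ) *
        Complex.I) • angularSchwartz χ j (Complex.polarCoord.symm p)) = χ p.1 * F p.1 p.2 := by
    rintro ⟨r, α⟩ hp
    have hr : 0 < r := hp.1
    have e : Complex.polarCoord.symm (r, α) = r * Complex.exp (α * Complex.I) := by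
      rw [Complex.polarCoord_symm_apply, Complex.exp_mul_I]; simp
    have hi : inner ℝ (Complex.polarCoord.symm (r, α)) w =
        r * (w.re * Real.cos α + w.im * Real.sin α) := by
      rw [Complex.inner, Complex.polarCoord_symm_apply]
      simp [-Complex.ofReal_cos, -Complex.ofReal_sin]
      ring
    rw [hi, e, angularSchwartz_apply, Complex.real_smul, smul_eq_mul, mul_left_comm,
      angularFunction_polar χ j hr, hF]
    dsimp only
    rw [mul_left_comm]
    congr 3
    push_cast
    ring
  have hFc : Continuous fun p : ℝ × ℝ => F p.1 p.2 := by
    simp only [hF]; fun_prop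
  have hFn : ∀ r α, ‖F r α‖ = 1 := by
    intro r α
    have e1 : -(2 * Real.pi * r * (w.re * Real.cos α + w.im * Real.sin α) * Complex.I) =
      ((-(2 * Real.pi * r * (w.re * Real.cos α + w.im * Real.sin α)) : ℝ) : ℂ) * Complex.I := by
      push_cast; ring
    have e2 : Complex.I * j * α = ((j * α : ℝ) : ℂ) * Complex.I := by push_cast; ring
    rw [hF]
    dsimp only
    rw [norm_mul, e1, e2, Complex.norm_exp_ofReal_mul_I, Complex.norm_exp_ofReal_mul_I, mul_one]
  rw [setIntegral_congr_fun polarCoord.open_target.measurableSet h1, polarCoord_target,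
    Measure.volume_eq_prod, setIntegral_prod]
  · refine integral_congr_ae (Filter.Eventually.of_forall fun r => ?_)
    dsimp only
    rw [integral_const_mul]
    congr 1
    rw [← integral_Ioc_eq_integral_Ioo, ← intervalIntegral.integral_of_le (by linarith [Real.pi_pos])]
    -- Polar coordinates use the angles `(-π, π)`; as `j` is an integer the integrand is
    -- `2π`-periodic, so the window can be moved to `[0, 2π]`.
    have hper : Function.Periodic (F r) (2 * Real.pi) := by
      intro α
      simp only [hF, Real.cos_add_two_pi, Real.sin_add_two_pi]
      congr 1
      rw [Complex.exp_eq_exp_iff_exists_int]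
      exact ⟨j, by push_cast; ring⟩
    have := hper.intervalIntegral_add_eq (-Real.pi) 0
    rw [show -Real.pi + 2 * Real.pi = Real.pi by ring, zero_add] at this
    exact this
  · rw [IntegrableOn, ← Measure.prod_restrict]
    -- Fubini: the integrand is `χ(r)` times a factor of modulus one, on an angular interval of
    -- finite length.
    have hχ : Integrable (fun r => (χ r : ℂ)) (volume.restrict (Set.Ioi 0)) :=
      ((χ.continuous.integrable_of_hasCompactSupport χ.hasCompactSupport).ofReal).restrict
    have h1 : Integrable (fun _ : ℝ => (1 : ℂ)) (volume.restrict (Set.Ioo (-Real.pi) Real.pi)) :=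
      integrable_const _
    have h2 := (hχ.mul_prod h1).mul_bdd (c := 1) hFc.aestronglyMeasurable
      (Filter.Eventually.of_forall fun p => (hFn p.1 p.2).le)
    simpa using h2

/-! ### Matrix elements paired with a test function -/

/-- The first column of a rotation matrix as a complex number. -/
def SO2.toComplex (R : SO2) : ℂ := (R.1 0 0 : ℂ) + (R.1 1 0 : ℂ) * Complex.I

/-- Keeps integer powers of the rotation continuous, negative exponents included. -/
theorem SO2.toComplex_ne_zero (R : SO2) : R.toComplex ≠ 0 := by
  obtain ⟨-, h2, h3⟩ := Matrix.mem_specialOrthogonalGroup_fin_two_iff.1 R.2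
  intro h
  have hre := congrArg Complex.re h
  have him := congrArg Complex.im h
  simp [SO2.toComplex] at hre him
  rw [h2, hre, him] at h3
  norm_num at h3

theorem SO2.continuous_toComplex : Continuous SO2.toComplex := by
  unfold SO2.toComplex
  have h (i j : Fin 2) : Continuous fun R : SO2 => ((R.1 i j : ℝ) : ℂ) :=
    Complex.continuous_ofReal.comp (continuous_subtype_val.matrix_elem i j)
  exact (h 0 0).add ((h 1 0).mul continuous_const)

theorem SO2.toComplex_rot (θ : ℝ) : (SO2.rot θ).toComplex = Complex.exp (θ * Complex.I) := by
  simp [SO2.toComplex, SO2.rot, Complex.exp_mul_I]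

/-- On ℂ the inverse rotation is multiplication by the conjugate of the first column, and `e_m` is
an `m`-th power, hence multiplicative. -/
theorem S1.e_rotate_inv_pt (m : ℤ) (R : SO2) (α : ℝ) :
    S1.e m (S1.rotate R⁻¹ (S1.pt α)) =
      conj R.toComplex ^ m * Complex.exp (Complex.I * m * α) := by
  obtain ⟨h1, h2, -⟩ := Matrix.mem_specialOrthogonalGroup_fin_two_iff.1 R.2
  rw [← S1.e_pt, S1.e, S1.e, ← mul_zpow]
  congr 1
  simp only [S1.rotate, S1.pt, SO2.act, SO2.coe_inv, SO2.toComplex, Matrix.mulVec, dotProduct,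
    Fin.sum_univ_two, Matrix.transpose_apply, h1, h2]
  apply Complex.ext
  · simp [-Complex.ofReal_cos, -Complex.ofReal_sin]
  · simp [-Complex.ofReal_cos, -Complex.ofReal_sin]
    ring

theorem SE2.u_eq (m n : ℤ) (g : SE2) (p : ℝ) :
    SE2.u m n g p = 1 / (2 * Real.pi) * conj g.R.toComplex ^ m *
      ∫ α in (0 : ℝ)..(2 * Real.pi),
        Complex.exp (-(p * (g.t 0 * Real.cos α + g.t 1 * Real.sin α) * Complex.I)) *
          Complex.exp (Complex.I * (m - n : ℤ) * α) := by
  rw [SE2.u, S1.innerL2, mul_assoc]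
  congr 1
  rw [← intervalIntegral.integral_const_mul]
  congr 1
  funext α
  have h1 : conj (S1.e n (S1.pt α)) = Complex.exp (-(Complex.I * n * α)) := by
    rw [S1.e_pt, ← Complex.exp_conj]
    simp
  have h2 : (inner ℝ (S1.pt α).1 g.t : ℝ) = g.t 0 * Real.cos α + g.t 1 * Real.sin α := by
    simp [S1.pt, PiLp.inner_apply, Fin.sum_univ_two]
  have h3 : Complex.exp (Complex.I * (m - n : ℤ) * α) =
      Complex.exp (Complex.I * m * α) * Complex.exp (-(Complex.I * n * α)) := by
    rw [← Complex.exp_add]; congr 1; push_cast; ring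
  have h4 : SE2.U p g (S1.e m) (S1.pt α) =
      Complex.exp (-(Complex.I * p * (inner ℝ (S1.pt α).1 g.t : ℝ))) *
        S1.e m (S1.rotate g.R⁻¹ (S1.pt α)) := rfl
  dsimp only
  rw [h4, h1, S1.e_rotate_inv_pt, h2, h3]
  have h5 : -(Complex.I * p * ((g.t 0 * Real.cos α + g.t 1 * Real.sin α : ℝ) : ℂ)) =
      -(p * (g.t 0 * Real.cos α + g.t 1 * Real.sin α) * Complex.I) := by push_cast; ring
  rw [h5]
  ring

theorem SE2.continuous_u (m n : ℤ) (g : SE2) : Continuous (SE2.u m n g) := by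
  rw [show SE2.u m n g = _ from funext (SE2.u_eq m n g)]
  refine continuous_const.mul
    (intervalIntegral.continuous_parametric_intervalIntegral_of_continuous' ?_ _ _)
  simp only [Function.uncurry_def]
  fun_prop

theorem regularDistribution_apply {f : ℝ → ℂ} (hf : Continuous f) (χ : 𝓓(PosLine, ℝ)) :
    regularDistribution f χ = ∫ p in Set.Ioi (0 : ℝ), (χ p : ℂ) * f p := by
  -- Local integrability is what identifies the abstract pairing with an honest integral.
  have h : LocallyIntegrableOn f PosLine (volume.restrict (Set.Ioi 0)) :=
    hf.locallyIntegrable.locallyIntegrableOn _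
  refine (TestFunction.integralAgainstBilinCLM_eq_integral h).trans ?_
  simp

/-- The translation part of an element of `SE(2)` as a complex number. -/
def SE2.translation (g : SE2) : ℂ := ⟨g.t 0, g.t 1⟩

/-- Matching the phase `σp⟨u, t⟩` with the Fourier phase `2πr⟨u, w⟩` at `r = p` forces `w =
σt/(2π)`. -/
theorem SE2.regularDistribution_u_apply (m n : ℤ) (σ : ℝ) (g : SE2) (b : ℂ)
    (χ : 𝓓(PosLine, ℝ)) :
    regularDistribution (fun p => SE2.u m n g (σ * p) * b) χ =
      b * conj g.R.toComplex ^ m * (1 / (2 * Real.pi) *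
        𝓕 (angularSchwartz χ (m - n)) ((σ / (2 * Real.pi)) • g.translation)) := by
  have hc : Continuous fun p => SE2.u m n g (σ * p) * b :=
    ((SE2.continuous_u m n g).comp (continuous_const.mul continuous_id)).mul continuous_const
  rw [regularDistribution_apply hc, fourier_angularSchwartz, ← mul_assoc, ← integral_const_mul]
  refine integral_congr_ae (Filter.Eventually.of_forall fun p => ?_)
  dsimp only
  rw [SE2.u_eq]
  have hpi : (Real.pi : ℂ) ≠ 0 := by exact_mod_cast Real.pi_ne_zero
  have h (α : ℝ) : ((σ * p : ℝ) : ℂ) * (g.t 0 * Real.cos α + g.t 1 * Real.sin α) =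
      2 * Real.pi * p * ((((σ / (2 * Real.pi)) • g.translation).re : ℝ) * Real.cos α +
        (((σ / (2 * Real.pi)) • g.translation).im : ℝ) * Real.sin α) := by
    simp only [SE2.translation, Complex.real_smul, Complex.re_ofReal_mul, Complex.im_ofReal_mul]
    push_cast
    field_simp
  simp only [h]
  ring

/-! ### Continuity of the integrand on the group -/

theorem SE2.continuous_t : Continuous SE2.t := 
  continuous_fst.comp (continuous_induced_dom (f := fun g : SE2 => (g.t, g.R)))

theorem SE2.continuous_R : Continuous SE2.R := 
  continuous_snd.comp (continuous_induced_dom (f := fun g : SE2 => (g.t, g.R)))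

theorem SE2.continuous_translation : Continuous SE2.translation := by
  have h (i : Fin 2) : Continuous fun g : SE2 => g.t i :=
    (EuclideanSpace.proj (𝕜 := ℝ) i).continuous.comp SE2.continuous_t
  have : SE2.translation = fun g => Complex.equivRealProdCLM.symm (g.t 0, g.t 1) := by
    funext g
    apply Complex.ext <;> simp [SE2.translation]
  rw [this]
  exact Complex.equivRealProdCLM.symm.continuous.comp ((h 0).prodMk (h 1))

theorem SE2.psi_coset (k₁ k₂ k₃ : ℤ) (g : SE2) :
    SE2.psi k₁ k₂ k₃ (SE2.coset g) =
      Complex.exp (2 * Real.pi * Complex.I * (k₁ * (g.t 0 : ℂ) + k₂ * (g.t 1 : ℂ))) *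
        g.R.toComplex ^ k₃ := rfl

theorem SE2.continuous_psi_coset (k₁ k₂ k₃ : ℤ) :
    Continuous fun g => SE2.psi k₁ k₂ k₃ (SE2.coset g) := by
  simp only [SE2.psi_coset]
  have h (i : Fin 2) : Continuous fun g : SE2 => ((g.t i : ℝ) : ℂ) :=
    Complex.continuous_ofReal.comp
      ((EuclideanSpace.proj (𝕜 := ℝ) i).continuous.comp SE2.continuous_t)
  refine Continuous.mul ?_ ((SO2.continuous_toComplex.comp SE2.continuous_R).zpow₀ _
    fun g => Or.inl (SO2.toComplex_ne_zero _))
  exact Complex.continuous_exp.comp (continuous_const.mul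
    ((continuous_const.mul (h 0)).add (continuous_const.mul (h 1))))

/-- Supplies the measurability needed to pull integrals back along `ofCoord`, since the Haar measure
is a pushforward. -/
theorem SE2.continuous_regularDistribution (m n k₁ k₂ k₃ : ℤ) (σ : ℝ) (χ : 𝓓(PosLine, ℝ)) :
    Continuous fun g : SE2 => regularDistribution
      (fun p => SE2.u m n g (σ * p) * conj (SE2.psi k₁ k₂ k₃ (SE2.coset g))) χ := by
  simp only [SE2.regularDistribution_u_apply]
  have ht : Continuous fun g : SE2 => (σ / (2 * Real.pi)) • g.translation :=
    (continuous_const_smul (σ / (2 * Real.pi))).comp SE2.continuous_translation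
  refine ((Complex.continuous_conj.comp (SE2.continuous_psi_coset k₁ k₂ k₃)).mul
    ((Complex.continuous_conj.comp (SO2.continuous_toComplex.comp SE2.continuous_R)).zpow₀ m
      fun g => Or.inl ?_)).mul (continuous_const.mul
        ((SchwartzMap.continuous _).comp ht))
  simpa using SO2.toComplex_ne_zero g.R

/-! ### Separation of variables and the two Fourier integrals -/

/-- The value of the integrand in the coordinates `(x₁, x₂, θ)`. -/
theorem SE2.regularDistribution_ofCoord (m n k₁ k₂ k₃ : ℤ) (σ : ℝ) (χ : 𝓓(PosLine, ℝ))
    (q : ℝ × ℝ × ℝ) :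
    regularDistribution (fun p => SE2.u m n (SE2.ofCoord q) (σ * p) *
        conj (SE2.psi k₁ k₂ k₃ (SE2.coset (SE2.ofCoord q)))) χ =
      (Complex.exp (((-2 * Real.pi * (k₁ * q.1 + k₂ * q.2.1) : ℝ) : ℂ) * Complex.I) *
        𝓕 (angularSchwartz χ (m - n)) ((σ / (2 * Real.pi)) • (⟨q.1, q.2.1⟩ : ℂ))) *
      (1 / (2 * Real.pi) * Complex.exp ((-(k₃ + m : ℤ) * Complex.I) * q.2.2)) := by
  obtain ⟨x, y, θ⟩ := q
  rw [SE2.regularDistribution_u_apply, SE2.psi_coset_ofCoord]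
  have h1 : (SE2.ofCoord (x, y, θ)).translation = ⟨x, y⟩ := by
    simp [SE2.translation, SE2.ofCoord]
  have h2 : conj (SE2.ofCoord (x, y, θ)).R.toComplex ^ m =
      Complex.exp (-(Complex.I * m * θ)) := by
    rw [SE2.ofCoord, SO2.toComplex_rot, ← Complex.exp_conj, ← Complex.exp_int_mul]
    congr 1
    simp
    ring
  have h3 : conj (Complex.exp (2 * Real.pi * Complex.I * (k₁ * x + k₂ * y)) *
      Complex.exp (Complex.I * k₃ * θ)) =
      Complex.exp (((-2 * Real.pi * (k₁ * x + k₂ * y) : ℝ) : ℂ) * Complex.I) *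
        Complex.exp (-(Complex.I * k₃ * θ)) := by
    rw [map_mul, ← Complex.exp_conj, ← Complex.exp_conj]
    congr 2
    · simp [Complex.conj_ofNat]
      ring
    · simp
  have h4 : Complex.exp ((-(k₃ + m : ℤ) * Complex.I) * θ) =
      Complex.exp (-(Complex.I * k₃ * θ)) * Complex.exp (-(Complex.I * m * θ)) := by
    rw [← Complex.exp_add]; congr 1; push_cast; ring
  dsimp only
  rw [h1, h2, h3, h4]
  ring

theorem integral_exp_int_mul_I (k : ℤ) :
    ∫ θ in (0 : ℝ)..(2 * Real.pi), Complex.exp ((k * Complex.I) * θ) =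
      if k = 0 then 2 * Real.pi else 0 := by
  split_ifs with hk
  · simp [hk]
  · rw [integral_exp_mul_complex (mul_ne_zero (Int.cast_ne_zero.2 hk) Complex.I_ne_zero)]
    have : Complex.exp (k * Complex.I * (2 * Real.pi : ℝ)) = 1 :=
      Complex.exp_eq_one_iff.2 ⟨k, by push_cast; ring⟩
    rw [this]
    simp

/-- Fourier inversion with a dilation of the plane. -/
theorem integral_exp_mul_fourier_smul (f : SchwartzMap ℂ ℂ) {a : ℝ} (ha : a ≠ 0) (κ : ℂ) :
    ∫ z : ℂ, Complex.exp (((-2 * Real.pi * (κ.re * z.re + κ.im * z.im) : ℝ) : ℂ) * Complex.I) *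
      𝓕 f (a • z) = ((a ^ 2)⁻¹ : ℝ) * f (-a⁻¹ • κ) := by
  have h0 : f (-a⁻¹ • κ) = ∫ z : ℂ, Complex.exp (((2 * Real.pi *
      inner ℝ z (-a⁻¹ • κ) : ℝ) : ℂ) * Complex.I) • 𝓕 f z := by
    rw [← Real.fourierInv_eq', ← SchwartzMap.fourierInv_coe, FourierTransform.fourierInv_fourier_eq]
  -- Substituting `a • z` gives the Jacobian `a⁻²` and divides the frequency by `a`; the minus sign
  -- in the character makes it `-a⁻¹ • κ`.
  have h1 := Measure.integral_comp_smul (volume : Measure ℂ) (fun z : ℂ => Complex.exp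
    (((2 * Real.pi * inner ℝ z (-a⁻¹ • κ) : ℝ) : ℂ) * Complex.I) • 𝓕 f z) a
  rw [← h0, Complex.finrank_real_complex, abs_of_nonneg (by positivity)] at h1
  rw [← Complex.real_smul, ← h1]
  refine integral_congr_ae (Filter.Eventually.of_forall fun z => ?_)
  have h2 : inner ℝ (a • z) (-a⁻¹ • κ) = -(κ.re * z.re + κ.im * z.im) := by
    rw [real_inner_smul_left, real_inner_smul_right, Complex.inner]
    field_simp
    simp
  dsimp only
  rw [h2, smul_eq_mul]
  congr 4
  ring

/-- The source of the absolute convergence: a dilated Schwartz function times a factor of modulus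
one. -/
theorem integrable_exp_mul_fourier_smul (f : SchwartzMap ℂ ℂ) {a : ℝ} (ha : a ≠ 0) (κ : ℂ) :
    Integrable fun z : ℂ => Complex.exp
      (((-2 * Real.pi * (κ.re * z.re + κ.im * z.im) : ℝ) : ℂ) * Complex.I) * 𝓕 f (a • z) := by
  refine ((𝓕 f).integrable.comp_smul ha).bdd_mul (c := 1) ?_ ?_
  · refine Continuous.aestronglyMeasurable ?_
    fun_prop
  · exact Filter.Eventually.of_forall fun z => (Complex.norm_exp_ofReal_mul_I _).le

/-! ### Haar integrals in coordinates -/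

/-- The coordinate domain with its Lebesgue measure is the product of the plane with `(0, 2π]`. -/
theorem measurePreserving_prodAssoc_restrict (t : Set ℝ) (ht : MeasurableSet t) :
    MeasurePreserving (MeasurableEquiv.prodAssoc : (ℝ × ℝ) × ℝ ≃ᵐ ℝ × ℝ × ℝ)
      ((volume : Measure (ℝ × ℝ)).prod (volume.restrict t))
      (volume.restrict {q : ℝ × ℝ × ℝ | q.2.2 ∈ t}) := by
  have h := (volume_preserving_prodAssoc (α₁ := ℝ) (β₁ := ℝ) (γ₁ := ℝ)).restrict_preimage
    (s := {q : ℝ × ℝ × ℝ | q.2.2 ∈ t}) (measurable_snd.snd ht)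
  have hs : (MeasurableEquiv.prodAssoc : (ℝ × ℝ) × ℝ ≃ᵐ ℝ × ℝ × ℝ) ⁻¹'
      {q : ℝ × ℝ × ℝ | q.2.2 ∈ t} = Set.univ ×ˢ t := by
    ext ⟨⟨x, y⟩, θ⟩
    simp [MeasurableEquiv.prodAssoc]
  rw [hs, Measure.volume_eq_prod, ← Measure.prod_restrict, Measure.restrict_univ] at h
  exact h

theorem SE2.integrable_haar_iff {f : SE2 → ℂ} (hf : Continuous f) :
    Integrable f SE2.haar ↔ Integrable
      (fun q : (ℝ × ℝ) × ℝ => f (SE2.ofCoord (q.1.1, q.1.2, q.2)))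
      ((volume : Measure (ℝ × ℝ)).prod (volume.restrict (Set.Ioc 0 (2 * Real.pi)))) := by
  have h := measurePreserving_prodAssoc_restrict (Set.Ioc 0 (2 * Real.pi)) measurableSet_Ioc
  rw [SE2.haar, integrable_smul_measure (by simp; positivity) ENNReal.ofReal_ne_top,
    integrable_map_measure hf.aestronglyMeasurable SE2.continuous_ofCoord.aemeasurable,
    ← h.integrable_comp_emb MeasurableEquiv.prodAssoc.measurableEmbedding]
  rfl

theorem SE2.integral_haar {f : SE2 → ℂ} (hf : Continuous f) :
    ∫ g, f g ∂SE2.haar = 1 / (4 * Real.pi ^ 2) *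
      ∫ q : (ℝ × ℝ) × ℝ, f (SE2.ofCoord (q.1.1, q.1.2, q.2))
      ∂((volume : Measure (ℝ × ℝ)).prod (volume.restrict (Set.Ioc 0 (2 * Real.pi)))) := by
  have h := measurePreserving_prodAssoc_restrict (Set.Ioc 0 (2 * Real.pi)) measurableSet_Ioc
  rw [SE2.haar, integral_smul_measure,
    integral_map SE2.continuous_ofCoord.aemeasurable hf.aestronglyMeasurable,
    ← h.integral_comp MeasurableEquiv.prodAssoc.measurableEmbedding,
    ENNReal.toReal_ofReal (by positivity), Complex.real_smul]
  push_cast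
  rfl

/-! ### Evaluation of the distribution -/

theorem SE2.isQ_of_apply (m n k₁ k₂ k₃ : ℤ) {σ : ℝ} (hσ : σ ^ 2 = 1) (Q : 𝓓'(PosLine, ℂ))
    (hQ : ∀ χ, Q χ = (if k₃ = -m then 1 else 0) *
      angularFunction χ (m - n) (-(2 * Real.pi * σ) • (⟨k₁, k₂⟩ : ℂ))) :
    SE2.IsQ k₁ k₂ k₃ (fun g p => SE2.u m n g (σ * p)) Q := by
  intro χ
  have hpi := Real.pi_pos
  have hσ0 : σ ≠ 0 := by rintro rfl; norm_num at hσ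
  have ha : σ / (2 * Real.pi) ≠ 0 := by positivity
  set A : ℝ × ℝ → ℂ := fun q =>
    Complex.exp (((-2 * Real.pi * (k₁ * q.1 + k₂ * q.2) : ℝ) : ℂ) * Complex.I) *
        𝓕 (angularSchwartz χ (m - n)) ((σ / (2 * Real.pi)) • (⟨q.1, q.2⟩ : ℂ))
  set B : ℝ → ℂ := fun θ =>
    1 / (2 * Real.pi) * Complex.exp ((-(k₃ + m : ℤ) * Complex.I) * θ) with hB
  have hcont := SE2.continuous_regularDistribution m n k₁ k₂ k₃ σ χ
  have hval (q : (ℝ × ℝ) × ℝ) := SE2.regularDistribution_ofCoord m n k₁ k₂ k₃ σ χ (q.1.1, q.1.2, q.2)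
  have hAint : Integrable A := by
    rw [← Complex.volume_preserving_equiv_real_prod.integrable_comp_emb
      Complex.measurableEquivRealProd.measurableEmbedding]
    exact integrable_exp_mul_fourier_smul (angularSchwartz χ (m - n)) ha ⟨k₁, k₂⟩
  have hBint : Integrable B (volume.restrict (Set.Ioc 0 (2 * Real.pi))) :=
    (Continuous.integrableOn_Ioc (by simp only [hB]; fun_prop))
  have hAval : ∫ q, A q = (((σ / (2 * Real.pi)) ^ 2)⁻¹ : ℝ) *
      angularFunction χ (m - n) (-(σ / (2 * Real.pi))⁻¹ • (⟨k₁, k₂⟩ : ℂ)) := by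
    rw [← Complex.volume_preserving_equiv_real_prod.integral_comp
      Complex.measurableEquivRealProd.measurableEmbedding]
    exact integral_exp_mul_fourier_smul (angularSchwartz χ (m - n)) ha ⟨k₁, k₂⟩
  -- The length `2π` of the circle cancels the `1/(2π)` of the inner product on `L²(𝕊¹)`.
  have hBval : ∫ θ in Set.Ioc 0 (2 * Real.pi), B θ = if k₃ = -m then 1 else 0 := by
    have h := integral_exp_int_mul_I (-(k₃ + m))
    rw [intervalIntegral.integral_of_le (by positivity)] at h
    push_cast at h
    simp only [hB, integral_const_mul]
    push_cast
    rw [h]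
    have hpi' : (Real.pi : ℂ) ≠ 0 := by exact_mod_cast hpi.ne'
    by_cases hk : k₃ = -m
    · rw [if_pos hk, if_pos (by omega)]
      push_cast
      field_simp
    · rw [if_neg hk, if_neg (by omega), Complex.ofReal_zero, mul_zero]
  have hinv : (σ / (2 * Real.pi))⁻¹ = 2 * Real.pi * σ := by
    field_simp
    linarith
  constructor
  · refine (SE2.integrable_haar_iff hcont).2 ?_
    simp only [hval]
    exact hAint.mul_prod hBint
  · rw [SE2.integral_haar hcont, hQ]
    simp only [hval]
    have h := integral_prod_mul (μ := (volume : Measure (ℝ × ℝ)))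
      (ν := volume.restrict (Set.Ioc 0 (2 * Real.pi))) A B
    rw [hAval, hBval, hinv] at h
    refine Eq.trans ?_ (congrArg _ h.symm)
    -- The inversion Jacobian `(σ/(2π))⁻² = 4π²` cancels the normalization `1/(4π²)` of the Haar
    -- measure.
    rw [div_pow, hσ]
    have hpi' : (Real.pi : ℂ) ≠ 0 := by exact_mod_cast hpi.ne'
    push_cast
    field_simp
    ring

/-- The point has modulus `2π√(k₁² + k₂²)` and direction `-σ e^{iΦ}`, whose `j`-th power is the
phase. The hypothesis `(k₁, k₂) ≠ (0, 0)` makes this direction meaningful. -/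
theorem angularFunction_smul (χ : 𝓓(PosLine, ℝ)) (j k₁ k₂ : ℤ) (hk : (k₁, k₂) ≠ (0, 0))
    {σ : ℝ} (hσ : σ ^ 2 = 1) :
    angularFunction χ j (-(2 * Real.pi * σ) • (⟨k₁, k₂⟩ : ℂ)) =
      (-σ : ℂ) ^ j * Complex.exp (Complex.I * j * polarAngle k₁ k₂) /
        (2 * Real.pi * Real.sqrt ((k₁ : ℝ) ^ 2 + (k₂ : ℝ) ^ 2)) *
        χ (2 * Real.pi * Real.sqrt ((k₁ : ℝ) ^ 2 + (k₂ : ℝ) ^ 2)) := by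
  set ρ := Real.sqrt ((k₁ : ℝ) ^ 2 + (k₂ : ℝ) ^ 2) with hρ
  have hρ0 : 0 < ρ := by
    refine Real.sqrt_pos.2 ?_
    by_cases h : k₁ = 0
    · have h2 : k₂ ≠ 0 := fun h2 => hk (by rw [h, h2])
      positivity
    · positivity
  have hpi := Real.pi_pos
  have hκ : (⟨k₁, k₂⟩ : ℂ) = ρ * Complex.exp (polarAngle k₁ k₂ * Complex.I) := by
    obtain ⟨h1, h2⟩ := polarAngle_spec k₁ k₂
    rw [Complex.exp_mul_I, ← Complex.ofReal_cos, ← Complex.ofReal_sin]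
    apply Complex.ext
    · simpa [-Complex.ofReal_cos, -Complex.ofReal_sin] using h1
    · simpa [-Complex.ofReal_cos, -Complex.ofReal_sin] using h2
  have hσ1 : |σ| = 1 := by
    rcases sq_eq_sq_iff_eq_or_eq_neg.1 (hσ.trans (one_pow 2).symm) with h | h <;> simp [h]
  have hn : ‖-(2 * Real.pi * σ) • (⟨k₁, k₂⟩ : ℂ)‖ = 2 * Real.pi * ρ := by
    rw [hκ, norm_smul, norm_mul, Complex.norm_exp_ofReal_mul_I, Complex.norm_real, norm_neg,
      norm_mul, Real.norm_eq_abs σ, hσ1, Real.norm_of_nonneg hρ0.le,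
      Real.norm_of_nonneg (by positivity)]
    ring
  have hpi' : (Real.pi : ℂ) ≠ 0 := by exact_mod_cast hpi.ne'
  have hρ' : (ρ : ℂ) ≠ 0 := by exact_mod_cast hρ0.ne'
  have hu : -(2 * Real.pi * σ) • (⟨k₁, k₂⟩ : ℂ) * ((2 * Real.pi * ρ : ℝ) : ℂ)⁻¹ =
      (-σ : ℂ) * Complex.exp (polarAngle k₁ k₂ * Complex.I) := by
    rw [hκ, Complex.real_smul]
    push_cast
    field_simp
  have he : Complex.exp (polarAngle k₁ k₂ * Complex.I) ^ j =
      Complex.exp (Complex.I * j * polarAngle k₁ k₂) := by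
    rw [← Complex.exp_int_mul]; congr 1; ring
  rw [angularFunction, hn, hu, mul_zpow, he]
  push_cast
  field_simp

theorem mainTheorem9 (m n k₁ k₂ k₃ : ℤ) (hk : (k₁, k₂) ≠ (0, 0)) :
    SE2.IsQ k₁ k₂ k₃ (fun g p => SE2.u m n g (-p))
        (((if k₃ = -m then 1 else 0) *
            Complex.exp (Complex.I * (m - n) * polarAngle k₁ k₂) /
            (2 * Real.pi * Real.sqrt ((k₁ : ℝ) ^ 2 + (k₂ : ℝ) ^ 2)) : ℂ) •
          dirac (2 * Real.pi * Real.sqrt ((k₁ : ℝ) ^ 2 + (k₂ : ℝ) ^ 2))) ∧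
      SE2.IsQ k₁ k₂ k₃ (fun g p => SE2.u m n g p)
        (((-1) ^ (m - n) * (if k₃ = -m then 1 else 0) *
            Complex.exp (Complex.I * (m - n) * polarAngle k₁ k₂) /
            (2 * Real.pi * Real.sqrt ((k₁ : ℝ) ^ 2 + (k₂ : ℝ) ^ 2)) : ℂ) •
          dirac (2 * Real.pi * Real.sqrt ((k₁ : ℝ) ^ 2 + (k₂ : ℝ) ^ 2))) := by
  have happ (c : ℂ) (a : ℝ) (χ : 𝓓(PosLine, ℝ)) : (c • dirac a) χ = c * (χ a : ℂ) := rfl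
  constructor
  -- Here `-σ = 1`, so no sign appears; in the other case `-σ = -1` leaves `(-1)^(m-n)`.
  · have h := SE2.isQ_of_apply m n k₁ k₂ k₃ (σ := -1) (by norm_num)
      (((if k₃ = -m then 1 else 0) *
            Complex.exp (Complex.I * (m - n) * polarAngle k₁ k₂) /
            (2 * Real.pi * Real.sqrt ((k₁ : ℝ) ^ 2 + (k₂ : ℝ) ^ 2)) : ℂ) •
          dirac (2 * Real.pi * Real.sqrt ((k₁ : ℝ) ^ 2 + (k₂ : ℝ) ^ 2))) (fun χ => by
        rw [angularFunction_smul χ (m - n) k₁ k₂ hk (by norm_num), happ]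
        push_cast
        rw [neg_neg, one_zpow]
        ring)
    simpa only [neg_one_mul] using h
  · have h := SE2.isQ_of_apply m n k₁ k₂ k₃ (σ := 1) (by norm_num)
      (((-1) ^ (m - n) * (if k₃ = -m then 1 else 0) *
            Complex.exp (Complex.I * (m - n) * polarAngle k₁ k₂) /
            (2 * Real.pi * Real.sqrt ((k₁ : ℝ) ^ 2 + (k₂ : ℝ) ^ 2)) : ℂ) •
          dirac (2 * Real.pi * Real.sqrt ((k₁ : ℝ) ^ 2 + (k₂ : ℝ) ^ 2))) (fun χ => by
        rw [angularFunction_smul χ (m - n) k₁ k₂ hk (by norm_num), happ]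
        push_cast
        ring)
    simpa only [one_mul] using h
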